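/- A divisor $d$ of a positive integer $n$ is called a unitary divisor of $n$ if $\gcd(d, n/d) = 1$; let $\sigma^*(n)$ denote the sum of the unitary divisors of $n$. A positive integer $N$ is called unitary super perfect if $\sigma^*(\sigma^*(N)) = 2N$. Theorem. An odd positive integer $N$ is unitary super perfect if and only if $N = 9$ or $N = 165$. In particular, there are only finitely many odd unitary super perfect numbers. -/

import Mathlib

/-- `d` is a unitary divisor of `n`: `d` divides `n` and `d` is coprime to `n / d`. -/
def IsUnitaryDivisor (d n : ℕ) : Prop :=
  d ∣ n ∧ Nat.Coprime d (n / d)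

instance (d n : ℕ) : Decidable (IsUnitaryDivisor d n) :=
  inferInstanceAs (Decidable (d ∣ n ∧ Nat.Coprime d (n / d)))

/-- The sum `σ*(n)` of the unitary divisors of a positive integer `n` (with value `0` at `0`). -/
def unitarySigma (n : ℕ) : ℕ :=
  ∑ d ∈ n.divisors with IsUnitaryDivisor d n, d

/-- `N` is unitary super perfect: `N` is a positive integer with `σ*(σ*(N)) = 2N`. -/
def IsUnitarySuperPerfect (N : ℕ) : Prop :=
  0 < N ∧ unitarySigma (unitarySigma N) = 2 * N

/-!
Let `N > 1` be odd with `σ*(σ*(N)) = 2 N`. The number `σ*` is the product of `x + 1` over the maximal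
prime powers `x` dividing its argument. Every odd prime power contributes an even factor, and `2 N`
is divisible by `2` only once, so `σ*(N) = 2 ^ f * q ^ g` for a single odd prime `q`, and
`(2 ^ f + 1) * (q ^ g + 1) = 2 N` (`exists_isSuperPerfectShape`).

Let `x = p ^ e` be a maximal prime power dividing `N`. Then `x + 1 = 2 ^ a * q ^ b`. Since `p` divides
`2 ^ f + 1` or `q ^ g + 1`, the quadratic characters of `-1` and `-2` together with quadratic
reciprocity force `a ≤ 2`, or else `b = 0` with `a` odd and `g` odd
(`IsSuperPerfectShape.classification`). Hence the possible `x` are `3` and the members of three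
sequences: `2 * q ^ b - 1` and `4 * q ^ b - 1` with `b ≥ 1`, and `2 ^ a - 1` with `a ≥ 3` odd.

The exact identity `∏ x / (x + 1) = (1 + 2 ^ (-f)) * (1 + q ^ (-g)) / 2` now does the work. The left
side is bounded below by Weierstrass' inequality `∏ (1 - t) ≥ 1 - ∑ t`, applied to each sequence,
where the sum is dominated by a geometric series (`DefectBound`); the right side is close to `1 / 2`
as soon as `2 ^ f` and `q ^ g` are not tiny. These bounds (`two_mul_le_of_defectBound`) contradict
each other when `f` is even. When `f ≥ 3` is odd they force `3` to be one of the `x`, so `9 ∤ N`; this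
excludes `f = 3` and `3 ∣ q ^ g + 1`, which for odd `g` gives `q ≥ 13` and a contradiction, and for
even `g` leaves only `q = 3`. There the same bounds force `5` to be one of the `x`, congruences modulo
`5` and `17` then exclude `17`, and a last bound leaves `g = 2`, hence `N = 165`. The remaining case `f = 1` gives `N = 9`.
-/

/-! ### The unitary divisor sum as a product over prime powers -/

lemma isUnitaryDivisor_iff {d n : ℕ} (hn : n ≠ 0) :
    IsUnitaryDivisor d n ↔ ∃ e, n = d * e ∧ Nat.Coprime d e := by
  constructor
  · rintro ⟨⟨e, rfl⟩, h⟩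
    have hd : 0 < d := Nat.pos_of_ne_zero (by rintro rfl; simp at hn)
    rw [Nat.mul_div_cancel_left _ hd] at h
    exact ⟨e, rfl, h⟩
  · rintro ⟨e, rfl, h⟩
    have hd : 0 < d := Nat.pos_of_ne_zero (by rintro rfl; simp at hn)
    exact ⟨dvd_mul_right _ _, by rwa [Nat.mul_div_cancel_left _ hd]⟩

lemma mem_filter_isUnitaryDivisor {d n : ℕ} (hn : n ≠ 0) :
    d ∈ n.divisors.filter (fun d => IsUnitaryDivisor d n) ↔ ∃ e, n = d * e ∧ Nat.Coprime d e := by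
  rw [Finset.mem_filter, Nat.mem_divisors, isUnitaryDivisor_iff hn]
  exact ⟨fun h => h.2, fun ⟨e, he, h⟩ => ⟨⟨⟨e, he⟩, hn⟩, e, he, h⟩⟩

lemma unitarySigma_one : unitarySigma 1 = 1 := by decide

lemma unitarySigma_mul {m n : ℕ} (h : m.Coprime n) :
    unitarySigma (m * n) = unitarySigma m * unitarySigma n := by
  rcases eq_or_ne m 0 with rfl | hm
  · simp [unitarySigma]
  rcases eq_or_ne n 0 with rfl | hn
  · simp [unitarySigma]
  unfold unitarySigma
  rw [Finset.sum_mul_sum, ← Finset.sum_product']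
  symm
  refine Finset.sum_nbij' (fun x => x.1 * x.2) (fun d => (m.gcd d, n.gcd d)) ?_ ?_ ?_ ?_ ?_
  · rintro ⟨a, b⟩ hx
    rw [Finset.mem_product, mem_filter_isUnitaryDivisor hm, mem_filter_isUnitaryDivisor hn] at hx
    obtain ⟨⟨a', ha, haa⟩, b', hb, hbb⟩ := hx
    dsimp only at *
    rw [mem_filter_isUnitaryDivisor (mul_ne_zero hm hn)]
    subst ha hb
    refine ⟨a' * b', by ring, ?_⟩
    simp only [Nat.coprime_mul_iff_left, Nat.coprime_mul_iff_right] at h ⊢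
    exact ⟨⟨haa, h.1.2.symm⟩, h.2.1, hbb⟩
  · intro d hd
    rw [mem_filter_isUnitaryDivisor (mul_ne_zero hm hn)] at hd
    obtain ⟨e, he, hde⟩ := hd
    rw [Finset.mem_product, mem_filter_isUnitaryDivisor hm, mem_filter_isUnitaryDivisor hn]
    have key : ∀ k, k ∣ m * n → k = k.gcd d * k.gcd e := fun k hk => by
      rw [← hde.gcd_mul, ← he, Nat.gcd_eq_left hk]
    exact ⟨⟨m.gcd e, key m (dvd_mul_right _ _),
        Nat.Coprime.of_dvd (Nat.gcd_dvd_right _ _) (Nat.gcd_dvd_right _ _) hde⟩,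
      n.gcd e, key n (dvd_mul_left _ _),
        Nat.Coprime.of_dvd (Nat.gcd_dvd_right _ _) (Nat.gcd_dvd_right _ _) hde⟩
  · rintro ⟨a, b⟩ hx
    rw [Finset.mem_product, mem_filter_isUnitaryDivisor hm, mem_filter_isUnitaryDivisor hn] at hx
    obtain ⟨⟨a', ha, haa⟩, b', hb, hbb⟩ := hx
    dsimp only at *
    have h1 : m.Coprime b := h.coprime_dvd_right ⟨b', hb⟩
    have h2 : n.Coprime a := h.symm.coprime_dvd_right ⟨a', ha⟩
    rw [Nat.Coprime.gcd_mul_right_cancel_right _ h1.symm,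
      Nat.Coprime.gcd_mul_left_cancel_right _ h2.symm,
      Nat.gcd_eq_right ⟨a', ha⟩, Nat.gcd_eq_right ⟨b', hb⟩]
  · intro d hd
    rw [mem_filter_isUnitaryDivisor (mul_ne_zero hm hn)] at hd
    obtain ⟨e, he, hde⟩ := hd
    dsimp only
    rw [Nat.gcd_comm m, Nat.gcd_comm n, ← h.gcd_mul, Nat.gcd_eq_left ⟨e, he⟩]
  · rintro ⟨a, b⟩ _
    rfl

lemma unitarySigma_prime_pow {p k : ℕ} (hp : p.Prime) (hk : k ≠ 0) :
    unitarySigma (p ^ k) = p ^ k + 1 := by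
  have hpk : p ^ k ≠ 0 := pow_ne_zero _ hp.ne_zero
  have h1 : 1 < p ^ k := Nat.one_lt_pow hk hp.one_lt
  have : (p ^ k).divisors.filter (fun d => IsUnitaryDivisor d (p ^ k)) = {p ^ k, 1} := by
    ext d
    rw [mem_filter_isUnitaryDivisor hpk, Finset.mem_insert, Finset.mem_singleton]
    constructor
    · rintro ⟨e, he, hde⟩
      obtain ⟨i, -, rfl⟩ := (Nat.dvd_prime_pow hp).1 ⟨e, he⟩
      obtain ⟨j, -, rfl⟩ := (Nat.dvd_prime_pow hp).1 (Dvd.intro_left _ he.symm)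
      rcases Nat.eq_zero_or_pos i with rfl | hi
      · simp
      rcases Nat.eq_zero_or_pos j with rfl | hj
      · left; simpa using he.symm
      · exact absurd hde (Nat.not_coprime_of_dvd_of_dvd hp.one_lt (dvd_pow_self p hi.ne')
          (dvd_pow_self p hj.ne'))
    · rintro (rfl | rfl)
      · exact ⟨1, by simp, by simp⟩
      · exact ⟨p ^ k, by simp, by simp⟩
  rw [unitarySigma, this, Finset.sum_pair h1.ne']

/-- The maximal prime powers dividing `n`, that is, the prime powers that are unitary divisors
of `n`. -/
def unitaryPrimePowers (n : ℕ) : Finset ℕ :=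
  n.primeFactors.image (fun p => p ^ n.factorization p)

lemma mem_unitaryPrimePowers {n x : ℕ} (hn : n ≠ 0) (hx : x ∈ unitaryPrimePowers n) :
    ∃ p e, p.Prime ∧ e ≠ 0 ∧ x = p ^ e ∧ x ∣ n ∧ ¬ p * x ∣ n := by
  obtain ⟨p, hp, rfl⟩ := Finset.mem_image.1 hx
  have hpp := Nat.prime_of_mem_primeFactors hp
  refine ⟨p, n.factorization p, hpp, ?_, rfl, Nat.ordProj_dvd n p, ?_⟩
  · exact (hpp.factorization_pos_of_dvd hn (Nat.dvd_of_mem_primeFactors hp)).ne'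
  · rw [← pow_succ']
    exact Nat.pow_succ_factorization_not_dvd hn hpp

lemma prod_unitaryPrimePowers {M : Type*} [CommMonoid M] {n : ℕ} (f : ℕ → M) :
    ∏ x ∈ unitaryPrimePowers n, f x = n.factorization.prod (fun p k => f (p ^ k)) := by
  rw [unitaryPrimePowers, Finset.prod_image, Finsupp.prod, Nat.support_factorization]
  intro p hp r hr h
  have hp' := Nat.prime_of_mem_primeFactors hp
  have hr' := Nat.prime_of_mem_primeFactors hr
  have h0 := Nat.mem_primeFactors.1 hp
  dsimp only at h
  have : p ∣ r ^ n.factorization r :=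
    h ▸ dvd_pow_self p (hp'.factorization_pos_of_dvd h0.2.2 h0.2.1).ne'
  exact (Nat.prime_dvd_prime_iff_eq hp' hr').1 (hp'.dvd_of_dvd_pow this)

lemma prod_unitaryPrimePowers_eq_self {n : ℕ} (hn : n ≠ 0) :
    ∏ x ∈ unitaryPrimePowers n, x = n := by
  rw [prod_unitaryPrimePowers (fun x => x)]
  exact Nat.prod_factorization_pow_eq_self hn

lemma unitarySigma_eq_prod {n : ℕ} (hn : n ≠ 0) :
    unitarySigma n = ∏ x ∈ unitaryPrimePowers n, (x + 1) := by
  rw [prod_unitaryPrimePowers (fun x => x + 1),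
    Nat.multiplicative_factorization unitarySigma (fun _ _ => unitarySigma_mul) unitarySigma_one hn]
  refine Finset.prod_congr rfl fun p hp => ?_
  rw [Nat.support_factorization] at hp
  have h0 := Nat.mem_primeFactors.1 hp
  exact unitarySigma_prime_pow h0.1 (h0.1.factorization_pos_of_dvd hn h0.2.1).ne'

/-! ### Lower bounds for `∏ x / (x + 1)` -/

/-- The product of `x / (x + 1)` over a finite set of natural numbers. -/
def defectProd (s : Finset ℕ) : ℚ := ∏ x ∈ s, (1 - 1 / ((x : ℚ) + 1))

/-- The numbers of the form `c * r ^ n - 1`. -/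
def IsPredGeom (c r x : ℕ) : Prop := ∃ n, x + 1 = c * r ^ n

lemma defectProd_factor_nonneg (x : ℕ) : 0 ≤ (1 - 1 / ((x : ℚ) + 1)) := by
  rw [sub_nonneg, div_le_one (by positivity)]
  linarith [Nat.cast_nonneg (α := ℚ) x]

lemma defectProd_factor_le_one (x : ℕ) : (1 - 1 / ((x : ℚ) + 1)) ≤ 1 := by
  have : 0 ≤ 1 / ((x : ℚ) + 1) := by positivity
  linarith

lemma defectProd_nonneg (s : Finset ℕ) : 0 ≤ defectProd s :=
  Finset.prod_nonneg fun x _ => defectProd_factor_nonneg x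

lemma defectProd_le_one (s : Finset ℕ) : defectProd s ≤ 1 :=
  Finset.prod_le_one (fun x _ => defectProd_factor_nonneg x) fun x _ => defectProd_factor_le_one x

lemma one_sub_sum_le_defectProd (s : Finset ℕ) :
    1 - ∑ x ∈ s, 1 / ((x : ℚ) + 1) ≤ defectProd s := by
  induction s using Finset.induction_on with
  | empty => simp [defectProd]
  | insert a s ha ih =>
    have h1 : defectProd (insert a s) = (1 - 1 / ((a : ℚ) + 1)) * defectProd s :=
      Finset.prod_insert ha
    have h2 := defectProd_le_one s
    have h3 : 0 ≤ 1 / ((a : ℚ) + 1) := by positivity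
    rw [Finset.sum_insert ha, h1]
    nlinarith

/-- `A` bounds `defectProd` from below on every finite set whose members satisfy `P`. -/
def DefectBound (P : ℕ → Prop) (A : ℚ) : Prop :=
  ∀ s : Finset ℕ, (∀ x ∈ s, P x) → A ≤ defectProd s

lemma DefectBound.or {P Q : ℕ → Prop} {A B : ℚ} (hP : DefectBound P A) (hQ : DefectBound Q B)
    (hB : 0 ≤ B) : DefectBound (fun x => P x ∨ Q x) (A * B) := by
  classical
  intro s hs
  have h1 : defectProd (s.filter P) * defectProd (s.filter (fun x => ¬ P x)) = defectProd s :=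
    Finset.prod_filter_mul_prod_filter_not s P _
  rw [← h1]
  refine mul_le_mul (hP _ (by simp)) (hQ _ fun x hx => ?_) hB (defectProd_nonneg _)
  rw [Finset.mem_filter] at hx
  exact (hs x hx.1).resolve_left hx.2

lemma defectBound_eq (m : ℕ) : DefectBound (fun x => x = m) (1 - 1 / ((m : ℚ) + 1)) := by
  intro s hs
  rcases Finset.subset_singleton_iff.1 (fun x hx => Finset.mem_singleton.2 (hs x hx) : s ⊆ {m})
    with rfl | rfl
  · simpa [defectProd] using defectProd_factor_le_one m
  · simp [defectProd]

/-- Weierstrass' inequality combined with the sum of the geometric series. -/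
lemma defectBound_isPredGeom {c r : ℕ} (hc : 0 < c) (hr : 2 ≤ r) :
    DefectBound (IsPredGeom c r) (1 - (r : ℚ) / (c * (r - 1))) := by
  classical
  intro s hs
  choose! n hn using hs
  have hr' : (2 : ℚ) ≤ r := by exact_mod_cast hr
  have hc' : (0 : ℚ) < c := by exact_mod_cast hc
  have hinj : Set.InjOn n s := fun x hx y hy h => by
    have h1 := hn x hx
    rw [h, ← hn y hy] at h1
    omega
  have hgeom : ∀ K : ℕ, ∑ i ∈ Finset.range K, ((r : ℚ)⁻¹) ^ i ≤ r / (r - 1) := fun K => by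
    have hr1 : (r : ℚ)⁻¹ < 1 := inv_lt_one_of_one_lt₀ (by linarith)
    have hr0 : (0 : ℚ) < (r : ℚ)⁻¹ := by positivity
    have h1 := geom_sum_mul ((r : ℚ)⁻¹) K
    have h2 : (r : ℚ)⁻¹ * r = 1 := inv_mul_cancel₀ (by linarith)
    have h3 : 0 ≤ ((r : ℚ)⁻¹) ^ K := by positivity
    rw [le_div_iff₀ (by linarith)]
    calc (∑ i ∈ Finset.range K, ((r : ℚ)⁻¹) ^ i) * (r - 1)
        = -((∑ i ∈ Finset.range K, ((r : ℚ)⁻¹) ^ i) * ((r : ℚ)⁻¹ - 1)) * r := by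
          linear_combination (∑ i ∈ Finset.range K, ((r : ℚ)⁻¹) ^ i) * h2
      _ ≤ r := by rw [h1]; nlinarith
  have hsum : ∑ x ∈ s, 1 / ((x : ℚ) + 1) ≤ (r : ℚ) / (c * (r - 1)) := by
    calc ∑ x ∈ s, 1 / ((x : ℚ) + 1) = ∑ x ∈ s, (c : ℚ)⁻¹ * ((r : ℚ)⁻¹) ^ n x := by
          refine Finset.sum_congr rfl fun x hx => ?_
          have : ((x : ℚ) + 1) = c * r ^ n x := by exact_mod_cast hn x hx
          rw [this, one_div, mul_inv, inv_pow]
      _ = (c : ℚ)⁻¹ * ∑ i ∈ s.image n, ((r : ℚ)⁻¹) ^ i := by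
          rw [Finset.sum_image hinj, Finset.mul_sum]
      _ ≤ (c : ℚ)⁻¹ * ∑ i ∈ Finset.range ((s.image n).sup id + 1), ((r : ℚ)⁻¹) ^ i := by
          refine mul_le_mul_of_nonneg_left
            (Finset.sum_le_sum_of_subset_of_nonneg ?_ fun i _ _ => by positivity) (by positivity)
          intro i hi
          exact Finset.mem_range_succ_iff.2 (Finset.le_sup (f := id) hi)
      _ ≤ (c : ℚ)⁻¹ * (r / (r - 1)) := by gcongr; exact hgeom _
      _ = (r : ℚ) / (c * (r - 1)) := by
          rw [mul_comm (c : ℚ), ← div_div, div_eq_mul_inv _ (c : ℚ)]; ring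
  linarith [one_sub_sum_le_defectProd s]

lemma DefectBound.weaken {P : ℕ → Prop} {A B : ℚ} (h : DefectBound P A) (hB : B ≤ A) :
    DefectBound P B := fun s hs => hB.trans (h s hs)

lemma defectBound_mul_self {k r₀ r : ℕ} (hk : 0 < k) (h0 : 2 ≤ r₀) (hr : r₀ ≤ r) :
    DefectBound (IsPredGeom (k * r) r) (1 - 1 / (k * ((r₀ : ℚ) - 1))) := by
  refine (defectBound_isPredGeom (Nat.mul_pos hk (by omega)) (h0.trans hr)).weaken ?_
  have h0' : (2 : ℚ) ≤ r₀ := by exact_mod_cast h0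
  have hr' : (r₀ : ℚ) ≤ r := by exact_mod_cast hr
  have hk' : (0 : ℚ) < k := by exact_mod_cast hk
  have e : (r : ℚ) / (((k * r : ℕ) : ℚ) * (r - 1)) = 1 / (k * ((r : ℚ) - 1)) := by
    have : (r : ℚ) - 1 ≠ 0 := by linarith
    have : (r : ℚ) ≠ 0 := by linarith
    push_cast
    field_simp
  rw [e]
  have : (0 : ℚ) < r₀ - 1 := by linarith
  gcongr

/-! ### Unitary prime powers and quadratic residues -/

/-- The shape of an odd unitary super perfect number: `σ*(N)` has a single odd prime factor `q`,
so that `σ*(N) = 2 ^ f * q ^ g` and `σ*(σ*(N)) = (2 ^ f + 1) * (q ^ g + 1)`. -/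
structure IsSuperPerfectShape (N f g q : ℕ) : Prop where
  odd : Odd N
  prime : q.Prime
  ne_two : q ≠ 2
  f_ne_zero : f ≠ 0
  g_ne_zero : g ≠ 0
  prod_succ : ∏ x ∈ unitaryPrimePowers N, (x + 1) = 2 ^ f * q ^ g
  mul_eq : (2 ^ f + 1) * (q ^ g + 1) = 2 * N

lemma even_unitarySigma {n : ℕ} (h1 : n ≠ 1) (hn : Odd n) : Even (unitarySigma n) := by
  rw [unitarySigma_eq_prod hn.pos.ne', even_iff_two_dvd]
  obtain ⟨p, hp, hpn⟩ := Nat.exists_prime_and_dvd h1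
  have hmem : p ^ n.factorization p ∈ unitaryPrimePowers n :=
    Finset.mem_image_of_mem _ (Nat.mem_primeFactors.2 ⟨hp, hpn, hn.pos.ne'⟩)
  refine dvd_trans ?_ (Finset.dvd_prod_of_mem _ hmem)
  have : Odd (p ^ n.factorization p) := hn.of_dvd_nat (Nat.ordProj_dvd n p)
  exact even_iff_two_dvd.1 this.add_one

lemma exists_isSuperPerfectShape {N : ℕ} (hN : Odd N) (h : IsUnitarySuperPerfect N) :
    ∃ f g q, IsSuperPerfectShape N f g q := by
  have hN1 : N ≠ 1 := by
    rintro rfl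
    have := h.2
    rw [unitarySigma_one, unitarySigma_one] at this
    omega
  have hM := even_unitarySigma hN1 hN
  have hσ := h.2
  have hM0 : unitarySigma N ≠ 0 := by
    intro h0
    have h00 : unitarySigma 0 = 0 := by decide
    rw [h0, h00] at hσ
    have := hN.pos
    omega
  obtain ⟨f, m, hm, hMm⟩ := Nat.exists_eq_two_pow_mul_odd hM0
  have hf : f ≠ 0 := by
    rintro rfl
    rw [hMm, pow_zero, one_mul] at hM
    exact (Nat.not_even_iff_odd.2 hm) hM
  have hodd : Odd (2 ^ f + 1) := (Even.pow_of_ne_zero even_two hf).add_one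
  have hσ2 : (2 ^ f + 1) * unitarySigma m = 2 * N := by
    rw [← hσ, hMm, unitarySigma_mul (Nat.Coprime.pow_left _ (Nat.coprime_two_left.2 hm)),
      unitarySigma_prime_pow Nat.prime_two hf]
  have hm1 : m ≠ 1 := by
    rintro rfl
    rw [unitarySigma_one, mul_one] at hσ2
    rw [hσ2] at hodd
    exact (Nat.not_even_iff_odd.2 hodd) (even_two_mul N)
  obtain ⟨q, hq, hqm⟩ := Nat.exists_prime_and_dvd hm1
  obtain ⟨g, m', hqm', hmm⟩ := Nat.exists_eq_pow_mul_and_not_dvd hm.pos.ne' q hq.ne_one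
  have hg : g ≠ 0 := by
    rintro rfl
    rw [pow_zero, one_mul] at hmm
    exact hqm' (hmm ▸ hqm)
  have hqodd : Odd q := hm.of_dvd_nat hqm
  have hσm : unitarySigma m = (q ^ g + 1) * unitarySigma m' := by
    rw [hmm, unitarySigma_mul (Nat.Coprime.pow_left _ ((Nat.Prime.coprime_iff_not_dvd hq).2 hqm')),
      unitarySigma_prime_pow hq hg]
  -- A second odd prime factor would make the left side divisible by `4`.
  have hm'1 : m' = 1 := by
    by_contra hne
    have hm'odd : Odd m' := hm.of_dvd_nat ⟨q ^ g, by rw [hmm, mul_comm]⟩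
    obtain ⟨u, hu⟩ := even_unitarySigma hne hm'odd
    obtain ⟨v, hv⟩ := (hqodd.pow (n := g)).add_one
    obtain ⟨w, hw⟩ := hN
    have h4 : 4 ∣ 2 * N := by
      refine ⟨(2 ^ f + 1) * (v * u), ?_⟩
      rw [← hσ2, hσm, hu, hv]
      ring
    omega
  refine ⟨f, g, q, hN, hq, ?_, hf, hg, ?_, ?_⟩
  · rintro rfl
    exact (Nat.not_even_iff_odd.2 hqodd) even_two
  · rw [← unitarySigma_eq_prod hN.pos.ne', hMm, hmm, hm'1, mul_one]
  · rw [← hσ2, hσm, hm'1, unitarySigma_one, mul_one]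

/-- `2 ^ f ≡ -1` makes `-1` (for `f` even) or `-2` (for `f` odd) a square modulo `p`. -/
lemma odd_and_mod_eight_of_dvd_two_pow_add_one {p f : ℕ} (hp : p.Prime) (hp4 : p % 4 = 3)
    (h : p ∣ 2 ^ f + 1) : Odd f ∧ p % 8 = 3 := by
  have := Fact.mk hp
  have h0 : (2 : ZMod p) ^ f = -1 := by
    have h2 := (ZMod.natCast_eq_zero_iff _ _).2 h
    push_cast at h2
    exact eq_neg_of_add_eq_zero_left h2
  rcases Nat.even_or_odd' f with ⟨k, rfl | rfl⟩
  · exact absurd hp4 (ZMod.mod_four_ne_three_of_sq_eq_neg_one (y := 2 ^ k)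
      (by rw [← pow_mul, mul_comm, h0]))
  · refine ⟨odd_two_mul_add_one k, ?_⟩
    have h2 : IsSquare (-2 : ZMod p) := ⟨2 ^ (k + 1), by
      rw [← pow_add, show k + 1 + (k + 1) = (2 * k + 1) + 1 by ring, pow_succ, h0]; ring⟩
    have := (ZMod.exists_sq_eq_neg_two_iff (by omega : p ≠ 2)).1 h2
    omega

lemma odd_of_dvd_pow_add_one {p q g : ℕ} (hp : p.Prime) (hp4 : p % 4 = 3)
    (h : p ∣ q ^ g + 1) : Odd g := by
  have := Fact.mk hp
  have h0 : (q : ZMod p) ^ g = -1 := by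
    have h2 := (ZMod.natCast_eq_zero_iff _ _).2 h
    push_cast at h2
    exact eq_neg_of_add_eq_zero_left h2
  rcases Nat.even_or_odd' g with ⟨k, rfl | rfl⟩
  · exact absurd hp4 (ZMod.mod_four_ne_three_of_sq_eq_neg_one (y := (q : ZMod p) ^ k)
      (by rw [← pow_mul, mul_comm, h0]))
  · exact odd_two_mul_add_one k

/-- If `p ∣ q ^ g + 1` and `q ∣ p ^ e + 1` with odd exponents, then `-q` is a square modulo `p` and
`-p` is a square modulo `q`; for `q ≡ 1` and `p ≡ 3` modulo `4` this contradicts quadratic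
reciprocity. -/
lemma not_dvd_pow_add_one_of_dvd_pow_add_one {p q e g : ℕ} (hp : p.Prime) (hq : q.Prime)
    (hp4 : p % 4 = 3) (hq4 : q % 4 = 1) (he : Odd e) (hg : Odd g) (h : p ∣ q ^ g + 1) :
    ¬ q ∣ p ^ e + 1 := by
  intro h'
  have := Fact.mk hp
  have := Fact.mk hq
  have key : ∀ {a b n : ℕ}, Odd n → a ∣ b ^ n + 1 → IsSquare (-b : ZMod a) := by
    rintro a b n ⟨k, rfl⟩ hab
    have h2 := (ZMod.natCast_eq_zero_iff _ _).2 hab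
    push_cast at h2
    exact ⟨(b : ZMod a) ^ (k + 1), by linear_combination (-(b : ZMod a)) * h2⟩
  have h1 : IsSquare (-1 : ZMod q) := ZMod.exists_sq_eq_neg_one_iff.2 (by omega)
  have h2 : IsSquare (p : ZMod q) := by
    have := h1.mul (key he h')
    rwa [neg_one_mul, neg_neg] at this
  have h3 : IsSquare (q : ZMod p) :=
    (ZMod.exists_sq_eq_prime_iff_of_mod_four_eq_one hq4 (by omega)).1 h2
  obtain ⟨u, hu⟩ := h3
  obtain ⟨v, hv⟩ := key hg h
  have hq0 : (q : ZMod p) ≠ 0 := by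
    rw [Ne, ZMod.natCast_eq_zero_iff]
    intro hpq
    have := (Nat.prime_dvd_prime_iff_eq hp hq).1 hpq
    omega
  refine ZMod.mod_four_ne_three_of_sq_eq_neg_sq' (x := v) (y := u) ?_ ?_ hp4
  · rintro rfl
    exact hq0 (by rw [hu, mul_zero])
  · rw [sq, sq, ← hu, ← hv]

namespace IsSuperPerfectShape

variable {N f g q : ℕ}

lemma odd_q (h : IsSuperPerfectShape N f g q) : q % 2 = 1 :=
  Nat.odd_iff.1 (h.prime.odd_of_ne_two h.ne_two)

lemma mod_four_of_odd (h : IsSuperPerfectShape N f g q) (hg : Odd g) : q % 4 = 1 := by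
  have hN := Nat.odd_iff.1 h.odd
  have hq := h.odd_q
  by_contra hne
  have h3 : q % 4 = 3 := by omega
  obtain ⟨k, rfl⟩ := hg
  have h4 : q ^ (2 * k + 1) % 4 = 3 := by
    rw [pow_succ, pow_mul, Nat.mul_mod, Nat.pow_mod, Nat.pow_mod q 2, h3]
    norm_num
  have : 4 ∣ 2 * N := by
    rw [← h.mul_eq]
    exact Dvd.dvd.mul_left (by omega) _
  omega

lemma five_le_of_odd (h : IsSuperPerfectShape N f g q) (hg : Odd g) : 5 ≤ q := by
  have := h.mod_four_of_odd hg
  have := h.prime.two_le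
  omega

lemma three_le (h : IsSuperPerfectShape N f g q) : 3 ≤ q := by
  have := h.odd_q
  have := h.prime.two_le
  omega

lemma prod_succ_dvd (h : IsSuperPerfectShape N f g q) {s : Finset ℕ}
    (hs : s ⊆ unitaryPrimePowers N) : ∏ x ∈ s, (x + 1) ∣ 2 ^ f * q ^ g :=
  h.prod_succ ▸ Finset.prod_dvd_prod_of_subset _ _ _ hs

lemma succ_dvd (h : IsSuperPerfectShape N f g q) {x : ℕ} (hx : x ∈ unitaryPrimePowers N) :
    x + 1 ∣ 2 ^ f * q ^ g :=
  h.prod_succ ▸ Finset.dvd_prod_of_mem (fun x => x + 1) hx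

lemma odd_of_mem (h : IsSuperPerfectShape N f g q) {x : ℕ} (hx : x ∈ unitaryPrimePowers N) :
    x % 2 = 1 := by
  obtain ⟨p, e, -, -, -, hxN, -⟩ := mem_unitaryPrimePowers h.odd.pos.ne' hx
  exact Nat.odd_iff.1 (h.odd.of_dvd_nat hxN)

lemma exists_succ_eq (h : IsSuperPerfectShape N f g q) {x : ℕ}
    (hx : x ∈ unitaryPrimePowers N) : ∃ a b, x + 1 = 2 ^ a * q ^ b := by
  obtain ⟨u, v, hu, hv, huv⟩ := (Nat.dvd_mul).1 (h.succ_dvd hx)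
  obtain ⟨a, -, rfl⟩ := (Nat.dvd_prime_pow Nat.prime_two).1 hu
  obtain ⟨b, -, rfl⟩ := (Nat.dvd_prime_pow h.prime).1 hv
  exact ⟨a, b, huv.symm⟩

/-- The possible unitary prime powers of `N`. Those that are `3` modulo `4` come from primes
`p ≡ 3 [MOD 4]`. If `p ∣ 2 ^ f + 1`, then `p ≡ 3 [MOD 8]` and the power of `2` is `4`. Otherwise
`p ∣ q ^ g + 1`, and reciprocity leaves only the values `2 ^ a - 1`. -/
lemma classification (h : IsSuperPerfectShape N f g q) {x : ℕ}
    (hx : x ∈ unitaryPrimePowers N) :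
    (x = 3 ∧ (Odd f ∨ Odd g)) ∨ IsPredGeom (2 * q) q x ∨ (Odd f ∧ IsPredGeom (4 * q) q x) ∨
      (Odd g ∧ IsPredGeom 8 4 x ∧ x ∣ q ^ g + 1) := by
  have hN0 := h.odd.pos.ne'
  have hx2 := h.odd_of_mem hx
  obtain ⟨a, b, hab⟩ := h.exists_succ_eq hx
  obtain ⟨p, e, hp, he, hxp, hxN, -⟩ := mem_unitaryPrimePowers hN0 hx
  have hqb : q ^ b % 2 = 1 := by
    rw [Nat.pow_mod, h.odd_q, one_pow, Nat.one_mod]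
  have hx1 : 1 < x := hxp ▸ Nat.one_lt_pow he hp.one_lt
  have hpN : p ∣ N := (hxp ▸ dvd_pow_self p he : p ∣ x).trans hxN
  have hp2 : p % 2 = 1 := Nat.odd_iff.1 (h.odd.of_dvd_nat hpN)
  rcases a with _ | a
  · rw [pow_zero, one_mul] at hab; omega
  rcases a with _ | a
  · -- `x ≡ 1 [MOD 4]`
    right; left
    rcases b with _ | b
    · norm_num at hab; omega
    · exact ⟨b, by rw [hab]; ring⟩
  have hx4 : x % 4 = 3 := by
    have : x + 1 = 4 * (2 ^ a * q ^ b) := by rw [hab]; ring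
    omega
  have heo : Odd e := by
    by_contra hne
    obtain ⟨k, hk⟩ := Nat.not_odd_iff_even.1 hne
    have : x % 4 = 1 := by
      rw [hxp, hk, ← two_mul, pow_mul, Nat.pow_mod]
      have : p ^ 2 % 4 = 1 := by
        rw [Nat.pow_mod]
        have : p % 4 = 1 ∨ p % 4 = 3 := by omega
        rcases this with h | h <;> rw [h]
      rw [this, Nat.one_pow]
    omega
  obtain ⟨k, hk⟩ := heo
  have hx8 : x % 8 = p % 8 := by
    have h8 : p ^ 2 % 8 = 1 := by
      rw [Nat.pow_mod]
      have : p % 8 = 1 ∨ p % 8 = 3 ∨ p % 8 = 5 ∨ p % 8 = 7 := by omega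
      rcases this with h | h | h | h <;> rw [h]
    rw [hxp, hk, pow_succ, pow_mul, Nat.mul_mod, Nat.pow_mod, h8, Nat.one_pow]
    norm_num
  have hp4 : p % 4 = 3 := by omega
  by_cases hpf : p ∣ 2 ^ f + 1
  · obtain ⟨hfo, hp8⟩ := odd_and_mod_eight_of_dvd_two_pow_add_one hp hp4 hpf
    rcases a with _ | a
    · rcases b with _ | b
      · left; norm_num at hab; exact ⟨by omega, Or.inl hfo⟩
      · right; right; left
        exact ⟨hfo, b, by rw [hab]; ring⟩
    · have : x + 1 = 8 * (2 ^ a * q ^ b) := by rw [hab]; ring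
      omega
  · have hcop : Nat.Coprime x (2 ^ f + 1) :=
      hxp ▸ Nat.Coprime.pow_left _ ((Nat.Prime.coprime_iff_not_dvd hp).2 hpf)
    have hxq : x ∣ q ^ g + 1 := hcop.dvd_of_dvd_mul_left (h.mul_eq ▸ Dvd.dvd.mul_left hxN 2)
    have hpq : p ∣ q ^ g + 1 := (hxp ▸ dvd_pow_self p he : p ∣ x).trans hxq
    have hgo := odd_of_dvd_pow_add_one hp hp4 hpq
    have hb : b = 0 := by
      by_contra hb
      refine not_dvd_pow_add_one_of_dvd_pow_add_one hp h.prime hp4 (h.mod_four_of_odd hgo)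
        ⟨k, hk⟩ hgo hpq ?_
      rw [← hxp, hab]
      exact Dvd.dvd.mul_left (dvd_pow_self q hb) _
    subst hb
    rw [pow_zero, mul_one] at hab
    rcases Nat.even_or_odd' a with ⟨c, rfl | rfl⟩
    · -- The exponent of `2` is even, so `3 ∣ x`, whence `p = 3` and `x ≡ 3 [MOD 8]`.
      have h3 : x + 1 = 4 ^ (c + 1) := by
        rw [hab, show 2 * c + 1 + 1 = 2 * (c + 1) by ring, pow_mul]
        norm_num
      have h41 : 4 ^ (c + 1) % 3 = 1 := by rw [Nat.pow_mod]; norm_num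
      have h3x : 3 ∣ p ^ e := by rw [← hxp]; omega
      have hp3 : 3 = p := (Nat.prime_dvd_prime_iff_eq Nat.prime_three hp).1
        (Nat.prime_three.dvd_of_dvd_pow h3x)
      rcases c with _ | c
      · left; norm_num at h3; exact ⟨by omega, Or.inr hgo⟩
      · have : x + 1 = 8 * (2 * 4 ^ c) := by rw [h3]; ring
        omega
    · right; right; right
      refine ⟨hgo, ⟨c, ?_⟩, hxq⟩
      rw [hab, show 2 * c + 1 + 1 + 1 = 3 + 2 * c by ring, pow_add, pow_mul]
      norm_num

/-- The identity `∏ x / (x + 1) = (1 + 2 ^ (-f)) * (1 + q ^ (-g)) / 2` turned into an inequality: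
a lower bound for the left side contradicts lower bounds `F` and `G` for `2 ^ f` and `q ^ g`. -/
lemma two_mul_le_of_defectBound (h : IsSuperPerfectShape N f g q) {P : ℕ → Prop} {A : ℚ}
    (hA : DefectBound P A) (hP : ∀ x ∈ unitaryPrimePowers N, P x) {F G : ℕ} (hF0 : 0 < F)
    (hG0 : 0 < G) (hF : F ≤ 2 ^ f) (hG : G ≤ q ^ g) :
    2 * A ≤ (1 + 1 / (F : ℚ)) * (1 + 1 / (G : ℚ)) := by
  have hq0 : (0 : ℚ) < (q : ℚ) ^ g := by
    have := h.prime.pos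
    positivity
  have h1 : defectProd (unitaryPrimePowers N) * (2 ^ f * q ^ g) = N := by
    have e1 := congrArg (Nat.cast (R := ℚ)) h.prod_succ
    have e2 := congrArg (Nat.cast (R := ℚ)) (prod_unitaryPrimePowers_eq_self h.odd.pos.ne')
    push_cast at e1 e2
    rw [← e1, ← e2, defectProd, ← Finset.prod_mul_distrib]
    refine Finset.prod_congr rfl fun x _ => ?_
    have : (x : ℚ) + 1 ≠ 0 := by positivity
    field_simp
    ring
  have h2 : ((2 : ℚ) ^ f + 1) * ((q : ℚ) ^ g + 1) = 2 * N := by exact_mod_cast h.mul_eq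
  have h3 : 2 * defectProd (unitaryPrimePowers N) =
      (1 + 1 / (2 : ℚ) ^ f) * (1 + 1 / (q : ℚ) ^ g) := by
    field_simp
    linear_combination 2 * h1 - h2
  have hF' : (F : ℚ) ≤ 2 ^ f := by exact_mod_cast hF
  have hG' : (G : ℚ) ≤ (q : ℚ) ^ g := by exact_mod_cast hG
  have hF0' : (0 : ℚ) < F := by exact_mod_cast hF0
  have hG0' : (0 : ℚ) < G := by exact_mod_cast hG0
  calc 2 * A ≤ 2 * defectProd (unitaryPrimePowers N) := by linarith [hA _ hP]
    _ = _ := h3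
    _ ≤ _ := by gcongr

end IsSuperPerfectShape

/-! ### The case analysis on the exponents of `2` and `q` -/

namespace IsSuperPerfectShape

variable {N f g q : ℕ}

lemma pow_two_ge {n : ℕ} (hn : n ≤ f) : 2 ^ n ≤ 2 ^ f :=
  Nat.pow_le_pow_right (by norm_num) hn

lemma pow_q_ge {n r : ℕ} (hr : r ≤ q) (hr0 : 0 < r) (hn : n ≤ g) : r ^ n ≤ q ^ g :=
  (Nat.pow_le_pow_left hr n).trans (Nat.pow_le_pow_right (by omega) hn)

lemma eq_nine_of_f_eq_one (h : IsSuperPerfectShape N f g q) (hf : f = 1) : N = 9 := by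
  subst hf
  have hN0 := h.odd.pos.ne'
  have hcard : (unitaryPrimePowers N).card ≤ 1 := by
    rw [Finset.card_le_one]
    intro x hx y hy
    by_contra hxy
    have hd := h.prod_succ_dvd (s := {x, y}) (by simp [Finset.insert_subset_iff, hx, hy])
    rw [Finset.prod_pair hxy] at hd
    have h4 : 2 * 2 ∣ 2 ^ 1 * q ^ g :=
      (mul_dvd_mul (by have := h.odd_of_mem hx; omega)
        (by have := h.odd_of_mem hy; omega)).trans hd
    rw [pow_one] at h4
    have h2 := Nat.prime_two.dvd_of_dvd_pow ((mul_dvd_mul_iff_left two_ne_zero).1 h4)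
    have := h.odd_q
    omega
  have hprod := h.prod_succ
  have hself := prod_unitaryPrimePowers_eq_self hN0
  have hmul := h.mul_eq
  have hq : 0 < q ^ g := Nat.pow_pos h.prime.pos
  rcases Finset.card_le_one_iff_subset_singleton.1 hcard with ⟨x, hx⟩
  rcases Finset.subset_singleton_iff.1 hx with hx | hx
  · rw [hx, Finset.prod_empty] at hprod
    omega
  · rw [hx, Finset.prod_singleton] at hprod hself
    omega

lemma not_even_f (h : IsSuperPerfectShape N f g q) : ¬ Even f := by
  intro hf
  have hf2 : 2 ≤ f := by
    have := h.f_ne_zero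
    obtain ⟨k, hk⟩ := hf
    omega
  have hg1 : 1 ≤ g := Nat.one_le_iff_ne_zero.2 h.g_ne_zero
  rcases Nat.even_or_odd g with hg | hg
  · have hg2 : 2 ≤ g := by
      obtain ⟨k, hk⟩ := hg
      omega
    have hc : ∀ x ∈ unitaryPrimePowers N, IsPredGeom (2 * q) q x := fun x hx => by
      rcases h.classification hx with h1 | h1 | h1 | h1
      · have h2 := h1.2.resolve_left (Nat.not_odd_iff_even.2 hf)
        exact absurd hg (Nat.not_even_iff_odd.2 h2)
      · exact h1
      · exact absurd hf (Nat.not_even_iff_odd.2 h1.1)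
      · exact absurd hg (Nat.not_even_iff_odd.2 h1.1)
    have := h.two_mul_le_of_defectBound (defectBound_mul_self (k := 2) (by norm_num)
      (by norm_num) h.three_le) hc (by norm_num) (by norm_num)
      (pow_two_ge hf2) (pow_q_ge h.three_le (by norm_num) hg2)
    norm_num at this
  have hq5 := h.five_le_of_odd hg
  have hq4 := h.mod_four_of_odd hg
  have hc : ∀ x ∈ unitaryPrimePowers N, (x = 3 ∨ IsPredGeom (2 * q) q x) ∨
      (IsPredGeom 8 4 x ∧ x ∣ q ^ g + 1) := fun x hx => by
    rcases h.classification hx with h1 | h1 | h1 | h1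
    · exact Or.inl (Or.inl h1.1)
    · exact Or.inl (Or.inr h1)
    · exact absurd hf (Nat.not_even_iff_odd.2 h1.1)
    · exact Or.inr h1.2
  rcases (by omega : f = 2 ∨ 3 ≤ f) with rfl | hf3
  · have hno : ∀ x ∈ unitaryPrimePowers N, ¬ 8 ∣ x + 1 := fun x hx h8 => by
      have h2 : 4 * 2 ∣ 2 ^ 2 * q ^ g := h8.trans (h.succ_dvd hx)
      have := Nat.prime_two.dvd_of_dvd_pow ((mul_dvd_mul_iff_left four_ne_zero).1 h2)
      have := h.odd_q
      omega
    have hc' : ∀ x ∈ unitaryPrimePowers N, x = 3 ∨ IsPredGeom (2 * q) q x := fun x hx => by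
      refine (hc x hx).resolve_right ?_
      rintro ⟨⟨n, hn⟩, -⟩
      exact hno x hx ⟨_, hn⟩
    by_cases h3 : 3 ∈ unitaryPrimePowers N
    · -- The factor `3 + 1` already uses up the power of `2`, so `3` is the only member.
      have honly : unitaryPrimePowers N = {3} := by
        refine Finset.eq_singleton_iff_unique_mem.2 ⟨h3, fun x hx => ?_⟩
        by_contra hx3
        have hd := h.prod_succ_dvd (s := {3, x}) (by simp [Finset.insert_subset_iff, hx, h3])
        rw [Finset.prod_pair (Ne.symm hx3)] at hd
        have h4 : 4 * 2 ∣ 2 ^ 2 * q ^ g :=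
          (mul_dvd_mul_left 4 (by have := h.odd_of_mem hx; omega)).trans hd
        have := Nat.prime_two.dvd_of_dvd_pow ((mul_dvd_mul_iff_left four_ne_zero).1 h4)
        have := h.odd_q
        omega
      have hprod := h.prod_succ
      rw [honly, Finset.prod_singleton] at hprod
      have := Nat.one_lt_pow h.g_ne_zero h.prime.one_lt
      omega
    · have := h.two_mul_le_of_defectBound (defectBound_mul_self (k := 2) (by norm_num)
        (by norm_num) hq5) (fun x hx => (hc' x hx).resolve_left (by rintro rfl; exact h3 hx))
        (by norm_num) (by norm_num) (pow_two_ge le_rfl) (pow_q_ge hq5 (by norm_num) hg1)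
      norm_num at this
  have hf4 : 4 ≤ f := by
    obtain ⟨k, hk⟩ := hf
    omega
  have h84 := defectBound_isPredGeom (c := 8) (r := 4) (by norm_num) (by norm_num)
  rcases (by omega : q = 5 ∨ q = 9 ∨ 13 ≤ q) with rfl | rfl | hq13
  · have hb := (defectBound_eq 3).or (defectBound_mul_self (k := 2) (r₀ := 5) (r := 5)
      (by norm_num) (by norm_num) le_rfl) (by norm_num)
    obtain ⟨k, hk⟩ := hg
    rcases (by omega : g = 1 ∨ 3 ≤ g) with rfl | hg3
    · have hc' : ∀ x ∈ unitaryPrimePowers N, x = 3 ∨ IsPredGeom (2 * 5) 5 x := fun x hx => by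
        refine (hc x hx).resolve_right ?_
        rintro ⟨⟨n, hn⟩, hx6⟩
        have : 0 < 4 ^ n := by positivity
        have := Nat.le_of_dvd (by norm_num) hx6
        have : x = 7 := by omega
        subst this
        norm_num at hx6
      have := h.two_mul_le_of_defectBound hb hc' (by norm_num) (by norm_num)
        (pow_two_ge hf4) (pow_q_ge le_rfl (by norm_num) hg1)
      norm_num at this
    · have := h.two_mul_le_of_defectBound (hb.or h84 (by norm_num))
        (fun x hx => (hc x hx).imp_right And.left) (by norm_num) (by norm_num)
        (pow_two_ge hf4) (pow_q_ge le_rfl (by norm_num) hg3)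
      norm_num at this
  · exact absurd h.prime (by norm_num)
  · have hb := (defectBound_eq 3).or (defectBound_mul_self (k := 2) (r₀ := 13) (r := q)
      (by norm_num) (by norm_num) hq13) (by norm_num)
    have := h.two_mul_le_of_defectBound (hb.or h84 (by norm_num))
      (fun x hx => (hc x hx).imp_right And.left) (by norm_num) (by norm_num)
      (pow_two_ge hf4) (pow_q_ge hq13 (by norm_num) hg1)
    norm_num at this

/-- Without the factor `3 / 4`, the product of `x / (x + 1)` is too large. The margin is thin for
`q = 5`, where `175 / 128` is compared with `27 / 20`. -/
lemma three_mem (h : IsSuperPerfectShape N f g q) (hf3 : 3 ≤ f) :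
    3 ∈ unitaryPrimePowers N := by
  by_contra h3
  have hg1 : 1 ≤ g := Nat.one_le_iff_ne_zero.2 h.g_ne_zero
  have hc : ∀ x ∈ unitaryPrimePowers N, (IsPredGeom (2 * q) q x ∨ IsPredGeom (4 * q) q x) ∨
      (Odd g ∧ IsPredGeom 8 4 x) := fun x hx => by
    rcases h.classification hx with h1 | h1 | h1 | h1
    · exact absurd (h1.1 ▸ hx) h3
    · exact Or.inl (Or.inl h1)
    · exact Or.inl (Or.inr h1.2)
    · exact Or.inr ⟨h1.1, h1.2.1⟩
  rcases (by have := h.three_le; have := h.odd_q; omega : q = 3 ∨ 5 ≤ q) with rfl | hq5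
  · have hb := (defectBound_mul_self (k := 2) (r₀ := 3) (r := 3) (by norm_num) (by norm_num)
      le_rfl).or (defectBound_mul_self (k := 4) (r₀ := 3) (r := 3) (by norm_num) (by norm_num)
      le_rfl) (by norm_num)
    have hg : ¬ Odd g := fun hg => by simpa using h.mod_four_of_odd hg
    have hg2 : 2 ≤ g := by
      obtain ⟨k, hk⟩ := Nat.not_odd_iff_even.1 hg
      omega
    have := h.two_mul_le_of_defectBound hb
      (fun x hx => (hc x hx).resolve_right fun h1 => hg h1.1) (by norm_num) (by norm_num)
      (pow_two_ge hf3) (pow_q_ge le_rfl (by norm_num) hg2)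
    norm_num at this
  · have hb := (defectBound_mul_self (k := 2) (r := q) (by norm_num) (by norm_num)
      hq5).or (defectBound_mul_self (k := 4) (r := q) (by norm_num) (by norm_num)
      hq5) (by norm_num)
    have := h.two_mul_le_of_defectBound
      (hb.or (defectBound_isPredGeom (c := 8) (r := 4) (by norm_num) (by norm_num)) (by norm_num))
      (fun x hx => (hc x hx).imp_right And.right) (by norm_num) (by norm_num)
      (pow_two_ge hf3) (pow_q_ge hq5 (by norm_num) hg1)
    norm_num at this

/-- Since `3` is a unitary prime power of `N`, `9 ∤ N`, which rules out `f = 3`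
and `3 ∣ q ^ g + 1`. -/
lemma not_nine_dvd (h : IsSuperPerfectShape N f g q) (h3 : 3 ∈ unitaryPrimePowers N) :
    ¬ 9 ∣ (2 ^ f + 1) * (q ^ g + 1) := by
  obtain ⟨p, e, hp, he, hpe, -, hnd⟩ := mem_unitaryPrimePowers h.odd.pos.ne' h3
  have hp3 : p = 3 := (Nat.prime_dvd_prime_iff_eq hp Nat.prime_three).1
    (by rw [hpe]; exact dvd_pow_self p he)
  subst hp3
  rw [h.mul_eq]
  omega

lemma three_dvd_two_pow_add_one (hf : Odd f) : 3 ∣ 2 ^ f + 1 := by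
  simpa using hf.nat_add_dvd_pow_add_pow 2 1

lemma not_odd_g (h : IsSuperPerfectShape N f g q) (hf : Odd f) (hf5 : 5 ≤ f) : ¬ Odd g := by
  intro hg
  have hg1 : 1 ≤ g := Nat.one_le_iff_ne_zero.2 h.g_ne_zero
  have h9 := h.not_nine_dvd (h.three_mem (by omega))
  have hq4 := h.mod_four_of_odd hg
  have hq3 : q % 3 ≠ 2 := fun hq3 => by
    refine h9 (show 3 * 3 ∣ _ from mul_dvd_mul (three_dvd_two_pow_add_one hf) (dvd_trans ?_
      (by simpa using hg.nat_add_dvd_pow_add_pow q 1 : q + 1 ∣ q ^ g + 1)))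
    omega
  have hq30 : q % 3 ≠ 0 := fun hq3 => by
    have := (Nat.prime_dvd_prime_iff_eq Nat.prime_three h.prime).1 (Nat.dvd_of_mod_eq_zero hq3)
    omega
  have hq13 : 13 ≤ q := by
    have := h.prime.two_le
    omega
  have hb := (defectBound_eq 3).or (((defectBound_mul_self (k := 2) (r := q) (by norm_num)
    (by norm_num) hq13).or ((defectBound_mul_self (k := 4) (r := q) (by norm_num) (by norm_num)
    hq13).or (defectBound_isPredGeom (c := 8) (r := 4) (by norm_num) (by norm_num))
    (by norm_num)) (by norm_num))) (by norm_num)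
  have := h.two_mul_le_of_defectBound hb
    (fun x hx => (h.classification hx).imp And.left (Or.imp_right (Or.imp And.right
      fun h1 => h1.2.1)))
    (by norm_num) (by norm_num) (pow_two_ge hf5) (pow_q_ge hq13 (by norm_num) hg1)
  norm_num at this

lemma classification_of_even_g (h : IsSuperPerfectShape N f g q) (hg : ¬ Odd g) {x : ℕ}
    (hx : x ∈ unitaryPrimePowers N) :
    x = 3 ∨ IsPredGeom (2 * q) q x ∨ IsPredGeom (4 * q) q x := by
  rcases h.classification hx with h1 | h1 | h1 | h1
  · exact Or.inl h1.1
  · exact Or.inr (Or.inl h1)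
  · exact Or.inr (Or.inr h1.2)
  · exact absurd h1.1 hg

lemma eq_three_of_even_g (h : IsSuperPerfectShape N f g q) (hf5 : 5 ≤ f) (hg : ¬ Odd g)
    (hg2 : 2 ≤ g) : q = 3 := by
  by_contra hne
  have hq5 : 5 ≤ q := by
    have := h.three_le
    have := h.odd_q
    omega
  have hb := (defectBound_eq 3).or ((defectBound_mul_self (k := 2) (r := q) (by norm_num)
    (by norm_num) hq5).or (defectBound_mul_self (k := 4) (r := q) (by norm_num) (by norm_num)
    hq5) (by norm_num)) (by norm_num)
  have := h.two_mul_le_of_defectBound hb (fun x hx => h.classification_of_even_g hg hx)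
    (by norm_num) (by norm_num) (pow_two_ge hf5) (pow_q_ge hq5 (by norm_num) hg2)
  norm_num at this

/-- For `q = 3`, the product of `x / (x + 1)` cannot be small enough without the factor `5 / 6`. -/
lemma five_mem (h : IsSuperPerfectShape N f g 3) (hf5 : 5 ≤ f) (hg : ¬ Odd g) (hg2 : 2 ≤ g) :
    5 ∈ unitaryPrimePowers N := by
  by_contra h5
  have hb := (defectBound_eq 3).or ((defectBound_isPredGeom (c := 18) (r := 3) (by norm_num)
    (by norm_num)).or (defectBound_mul_self (k := 4) (r₀ := 3) (r := 3) (by norm_num) (by norm_num)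
    le_rfl) (by norm_num)) (by norm_num)
  have := h.two_mul_le_of_defectBound hb (fun x hx => ?_)
    (by norm_num) (by norm_num) (pow_two_ge hf5) (pow_q_ge le_rfl (by norm_num) hg2)
  · norm_num at this
  · refine (h.classification_of_even_g hg hx).imp_right (Or.imp_left ?_)
    rintro ⟨_ | n, hn⟩
    · exact absurd ((by omega : x = 5) ▸ hx) h5
    · exact ⟨n, by rw [hn]; ring⟩

/-- `5 ∣ 3 ^ g + 1` forces `g ≡ 2 [MOD 4]`, and then `17` divides neither
`2 ^ f + 1` nor `3 ^ g + 1`. With `17` missing, the product bound is too large as soon as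
`g ≥ 6`. -/
lemma g_eq_two (h : IsSuperPerfectShape N f g 3) (hf : Odd f) (hf5 : 5 ≤ f) (hg : ¬ Odd g)
    (hg2 : 2 ≤ g) : g = 2 := by
  have hN0 := h.odd.pos.ne'
  have hdvd : ∀ x ∈ unitaryPrimePowers N, x ∣ (2 ^ f + 1) * (3 ^ g + 1) := fun x hx => by
    obtain ⟨-, -, -, -, -, hxN, -⟩ := mem_unitaryPrimePowers hN0 hx
    rw [h.mul_eq]
    exact Dvd.dvd.mul_left hxN 2
  have hpow : ∀ a m k n r : ℕ, a ^ m % k = 1 → 1 < k → a ^ (m * n + r) % k = a ^ r % k :=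
    fun a m k n r hk h1 => by
      rw [pow_add, pow_mul, Nat.mul_mod, Nat.pow_mod, hk, Nat.one_pow, Nat.mod_eq_of_lt h1,
        one_mul, Nat.mod_mod]
  have hg4 : g % 4 = 2 := by
    by_contra hne
    have hg0 : g % 4 = 0 := by
      obtain ⟨k, hk⟩ := Nat.not_odd_iff_even.1 hg
      omega
    have e1 : 3 ^ g % 5 = 1 := by
      have := hpow 3 4 5 (g / 4) 0 (by norm_num) (by norm_num)
      rwa [show 4 * (g / 4) + 0 = g by omega] at this
    have e2 : 2 ^ f % 5 = 2 ∨ 2 ^ f % 5 = 3 := by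
      obtain ⟨k, hk⟩ := hf
      have := hpow 2 4 5 (f / 4) (f % 4) (by norm_num) (by norm_num)
      rw [Nat.div_add_mod] at this
      rcases (by omega : f % 4 = 1 ∨ f % 4 = 3) with h1 | h1 <;> rw [h1] at this <;>
        norm_num at this <;> omega
    rcases (Nat.Prime.dvd_mul Nat.prime_five).1 (hdvd 5 (h.five_mem hf5 hg hg2)) with h1 | h1 <;>
      omega
  by_contra hne
  have hg6 : 6 ≤ g := by omega
  have h17 : 17 ∉ unitaryPrimePowers N := fun hx => by
    have e1 : 3 ^ g % 17 = 9 ∨ 3 ^ g % 17 = 15 ∨ 3 ^ g % 17 = 8 ∨ 3 ^ g % 17 = 2 := by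
      have := hpow 3 16 17 (g / 16) (g % 16) (by norm_num) (by norm_num)
      rw [Nat.div_add_mod] at this
      rcases (by omega : g % 16 = 2 ∨ g % 16 = 6 ∨ g % 16 = 10 ∨ g % 16 = 14) with
        h1 | h1 | h1 | h1 <;> rw [h1] at this <;> norm_num at this <;> omega
    have e2 : 2 ^ f % 17 = 2 ∨ 2 ^ f % 17 = 8 ∨ 2 ^ f % 17 = 15 ∨ 2 ^ f % 17 = 9 := by
      obtain ⟨k, hk⟩ := hf
      have := hpow 2 8 17 (f / 8) (f % 8) (by norm_num) (by norm_num)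
      rw [Nat.div_add_mod] at this
      rcases (by omega : f % 8 = 1 ∨ f % 8 = 3 ∨ f % 8 = 5 ∨ f % 8 = 7) with
        h1 | h1 | h1 | h1 <;> rw [h1] at this <;> norm_num at this <;> omega
    rcases (Nat.Prime.dvd_mul (by norm_num)).1 (hdvd 17 hx) with h1 | h1 <;> omega
  have hb := (defectBound_eq 3).or (((defectBound_eq 5).or
    (defectBound_isPredGeom (c := 54) (r := 3) (by norm_num) (by norm_num)) (by norm_num)).or
    (defectBound_mul_self (k := 4) (r₀ := 3) (r := 3) (by norm_num) (by norm_num)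
    le_rfl) (by norm_num)) (by norm_num)
  have := h.two_mul_le_of_defectBound hb (fun x hx => ?_)
    (by norm_num) (by norm_num) (pow_two_ge hf5) (pow_q_ge le_rfl (by norm_num) hg6)
  · norm_num at this
  · refine (h.classification_of_even_g hg hx).imp_right (Or.imp_left ?_)
    rintro ⟨_ | _ | n, hn⟩
    · exact Or.inl (by omega)
    · exact absurd ((by omega : x = 17) ▸ hx) h17
    · exact Or.inr ⟨n, by rw [hn]; ring⟩

lemma eq_one_hundred_sixty_five (h : IsSuperPerfectShape N f 2 3) (hf5 : 5 ≤ f) :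
    N = 165 := by
  have h3 := h.three_mem (by omega)
  have h5 := h.five_mem hf5 (by decide) le_rfl
  have hcop : Nat.Coprime 27 (2 ^ f) := Nat.Coprime.pow_right _ (by norm_num)
  -- The factors `3 + 1` and `5 + 1` leave a single factor `3` for the remaining ones.
  have h9 : ∀ x ∈ unitaryPrimePowers N, x ≠ 3 → x ≠ 5 → ¬ 9 ∣ x + 1 := by
    rintro x hx hx3 hx5 ⟨y, hy⟩
    have hd := h.prod_succ_dvd (s := {3, 5, x}) (by simp [Finset.insert_subset_iff, hx, h3, h5])
    rw [Finset.prod_insert (by simp [hx3.symm]), Finset.prod_pair hx5.symm, hy] at hd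
    have h27 : 27 ∣ 3 ^ 2 := hcop.dvd_of_dvd_mul_left (dvd_trans ⟨8 * y, by ring⟩ hd)
    norm_num at h27
  have hsub : ∀ x ∈ unitaryPrimePowers N, x = 3 ∨ x = 5 ∨ x = 11 := by
    intro x hx
    by_contra! hne
    have hx9 := h9 x hx hne.1 hne.2.1
    rcases h.classification_of_even_g (by decide) hx with h1 | ⟨n, hn⟩ | ⟨n, hn⟩
    · exact hne.1 h1
    · rcases n with _ | n
      · omega
      · exact hx9 ⟨2 * 3 ^ n, by rw [hn]; ring⟩
    · rcases n with _ | n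
      · omega
      · exact hx9 ⟨4 * 3 ^ n, by rw [hn]; ring⟩
  have hself := prod_unitaryPrimePowers_eq_self h.odd.pos.ne'
  by_cases h11 : 11 ∈ unitaryPrimePowers N
  · have hU : unitaryPrimePowers N = {3, 5, 11} := by
      ext x
      simp only [Finset.mem_insert, Finset.mem_singleton]
      exact ⟨hsub x, by rintro (rfl | rfl | rfl) <;> assumption⟩
    rw [hU] at hself
    simpa using hself.symm
  · have hU : unitaryPrimePowers N = {3, 5} := by
      ext x
      simp only [Finset.mem_insert, Finset.mem_singleton]
      refine ⟨fun hx => ?_, by rintro (rfl | rfl) <;> assumption⟩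
      rcases hsub x hx with h1 | h1 | rfl
      · exact Or.inl h1
      · exact Or.inr h1
      · exact absurd hx h11
    have hprod := h.prod_succ
    rw [hU, Finset.prod_pair (by norm_num)] at hprod
    omega

lemma eq_nine_or (h : IsSuperPerfectShape N f g q) : N = 9 ∨ N = 165 := by
  rcases eq_or_ne f 1 with hf1 | hf1
  · exact Or.inl (h.eq_nine_of_f_eq_one hf1)
  right
  have hf : Odd f := Nat.not_even_iff_odd.1 h.not_even_f
  have hf3 : 3 ≤ f := by
    obtain ⟨k, hk⟩ := hf
    omega
  have hne3 : f ≠ 3 := by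
    rintro rfl
    exact h.not_nine_dvd (h.three_mem hf3) (Dvd.intro _ rfl)
  have hf5 : 5 ≤ f := by
    obtain ⟨k, hk⟩ := hf
    omega
  have hg := h.not_odd_g hf hf5
  have hg2 : 2 ≤ g := by
    have := h.g_ne_zero
    obtain ⟨k, hk⟩ := Nat.not_odd_iff_even.1 hg
    omega
  obtain rfl := h.eq_three_of_even_g hf5 hg hg2
  obtain rfl := h.g_eq_two hf hf5 hg hg2
  exact h.eq_one_hundred_sixty_five hf5

end IsSuperPerfectShape

lemma isUnitarySuperPerfect_nine : IsUnitarySuperPerfect 9 := by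
  refine ⟨by norm_num, ?_⟩
  decide +kernel

lemma isUnitarySuperPerfect_one_hundred_sixty_five : IsUnitarySuperPerfect 165 := by
  refine ⟨by norm_num, ?_⟩
  decide +kernel

/-- The odd unitary super perfect numbers are exactly `9` and `165`;
in particular there are only finitely many of them. -/
theorem theorem1p1 :
    (∀ N : ℕ, Odd N ∧ IsUnitarySuperPerfect N ↔ N = 9 ∨ N = 165) ∧
      {N : ℕ | Odd N ∧ IsUnitarySuperPerfect N}.Finite := by
  have key : ∀ N : ℕ, Odd N ∧ IsUnitarySuperPerfect N ↔ N = 9 ∨ N = 165 := fun N => by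
    constructor
    · rintro ⟨hN, h⟩
      obtain ⟨f, g, q, hS⟩ := exists_isSuperPerfectShape hN h
      exact hS.eq_nine_or
    · rintro (rfl | rfl)
      · exact ⟨by decide, isUnitarySuperPerfect_nine⟩
      · exact ⟨by decide, isUnitarySuperPerfect_one_hundred_sixty_five⟩
  refine ⟨key, (Set.toFinite {9, 165}).subset fun N hN => ?_⟩
  exact (key N).1 hN
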